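/- For $n\ge 1$, let $\mathcal G_{2\times n}$ be the $(2\times n)$-grid graph, with vertices $p_{i,j}$ ($1\le i\le n$, $j\in\{1,2\}$), where $p_{i,1}$ is adjacent to $p_{i,2}$ for $1\le i\le n$, and $p_{i,j}$ is adjacent to $p_{i+1,j}$ for $1\le i\le n-1$ and $j\in\{1,2\}$. A perfect matching of a graph $G$ is a set of pairwise disjoint edges of $G$ that covers every vertex. The perfect matching complex $\mathcal M_p(G)$ is the simplicial complex whose faces are the sets of edges of $G$ contained in some perfect matching of $G$, so that its facets are exactly the perfect matchings of $G$. **Theorem.** The (geometric realization of the) perfect matching complex $\mathcal M_p(\mathcal G_{2\times n})$ is contractible if $n$ is odd. If $n$ is even, written $n=2k+2$ with $k\ge 0$, it is homotopy equivalent to the $k$-dimensional sphere $\mathbb S^k$. -/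

import Mathlib

open scoped ContinuousMap

/-- The geometric realization of a simplicial complex on a finite type `ι`: the points of the
standard simplex in `ι → ℝ` (barycentric coordinates) whose support is contained in a face,
regarded, with the subspace topology, as a topological space. Elements of `ι` that are not
vertices of `K` contribute no points. -/
def PreAbstractSimplicialComplex.realization {ι : Type*} [Fintype ι]
    (K : PreAbstractSimplicialComplex ι) : Set (ι → ℝ) :=
  {x | x ∈ stdSimplex ℝ ι ∧ ∃ s ∈ K.faces, Function.support x ⊆ (s : Set ι)}

namespace SimpleGraph

/-- The perfect matching complex of a graph `G`: its (nonempty) faces are the nonempty finite sets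
of edges of `G` that are contained in the edge set of a perfect matching of `G`. For a finite graph
with at least one vertex, its facets are exactly the perfect matchings of `G`. -/
def perfectMatchingComplex {V : Type*} (G : SimpleGraph V) :
    PreAbstractSimplicialComplex (Sym2 V) where
  faces := {s | s.Nonempty ∧ ∃ M : G.Subgraph, M.IsPerfectMatching ∧ (s : Set (Sym2 V)) ⊆ M.edgeSet}
  isRelLowerSet_faces := by
    rintro s ⟨hs, M, hM, hsM⟩
    exact ⟨hs, fun t hts ht => ⟨ht, M, hM, (Finset.coe_subset.mpr hts).trans hsM⟩⟩

/-- The `2 × n` grid graph: the Cartesian product of the path on `n` vertices with the path on two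
vertices. The vertices are the pairs `(i, j)` with `i : Fin n` and `j : Fin 2`; two of them are
adjacent if they agree in one coordinate and differ by one in the other. -/
def gridGraph (n : ℕ) : SimpleGraph (Fin n × Fin 2) :=
  pathGraph n □ pathGraph 2

end SimpleGraph

/-! A set of grid edges lies in a perfect matching iff any two of its edges occupy disjoint or equal
sets of columns, so the complex is a flag complex (`realization_perfectMatchingComplex`). The two
horizontal edges over the same columns are compatible with the same edges; identifying them keeps
the homotopy type and turns vertices into tiles, intervals of one or two columns
(`nonempty_edge_homotopyEquiv`). From left to right, the tiles starting in column 2i+1 are folded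
onto {2i} (`foldTile_homotopic_id`). Over each pair of columns {2i} and {2i, 2i+1} survive,
compatible with everything except each other. For n = 2m this is the boundary of the m-dimensional
cross-polytope, a sphere of dimension m-1; for odd n the last column is a cone point. Relations need
not be reflexive: `R a a` says that `a` is a vertex, so non-edges and non-intervals contribute no
points. -/

/-- The geometric realization of the clique complex of a relation `R` on a finite type: the points
of the standard simplex any two elements of whose support are related. -/
def cliqueRealization {ι : Type*} [Fintype ι] (R : ι → ι → Prop) : Set (ι → ℝ) :=
  {x | x ∈ stdSimplex ℝ ι ∧ ∀ a b, x a ≠ 0 → x b ≠ 0 → R a b}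

/-! ### Flag complexes, induced maps and contiguity. -/

namespace cliqueRealization

variable {ι κ μ : Type*} [Fintype ι] {R : ι → ι → Prop} {S : κ → κ → Prop} {T : μ → μ → Prop}

/-- Maps into the realization that have a common face at every point are homotopic, by a straight
line. -/
theorem homotopic_of_contiguous [Fintype κ] {X : Type*} [TopologicalSpace X] [Std.Symm S]
    (F G : C(X, cliqueRealization S))
    (h : ∀ x a b, (F x).1 a ≠ 0 → (G x).1 b ≠ 0 → S a b) : F.Homotopic G := by
  refine ⟨⟨⟨fun p => ⟨(1 - (p.1 : ℝ)) • (F p.2).1 + (p.1 : ℝ) • (G p.2).1, ?_, ?_⟩, ?_⟩, ?_, ?_⟩⟩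
  · exact convex_stdSimplex ℝ κ (F p.2).2.1 (G p.2).2.1 (sub_nonneg.2 p.1.2.2) p.1.2.1 (by ring)
  · have key : ∀ a, ((1 - (p.1 : ℝ)) • (F p.2).1 + (p.1 : ℝ) • (G p.2).1) a ≠ 0 →
        (F p.2).1 a ≠ 0 ∨ (G p.2).1 a ≠ 0 := by
      intro a ha
      by_contra! hc
      simp [hc.1, hc.2] at ha
    intro a b ha hb
    rcases key a ha with ha | ha <;> rcases key b hb with hb | hb
    · exact (F p.2).2.2 a b ha hb
    · exact h _ a b ha hb
    · exact symm (h _ b a hb ha)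
    · exact (G p.2).2.2 a b ha hb
  · fun_prop
  · intro x; ext; simp
  · intro x; ext; simp

variable [DecidableEq κ] [DecidableEq μ]

theorem exists_of_sum_filter_ne_zero {f : ι → κ} {x : ι → ℝ} {k : κ}
    (h : ∑ a with f a = k, x a ≠ 0) : ∃ a, f a = k ∧ x a ≠ 0 := by
  obtain ⟨a, ha, hx⟩ := Finset.exists_ne_zero_of_sum_ne_zero h
  exact ⟨a, (Finset.mem_filter.1 ha).2, hx⟩

variable [Fintype κ] [Fintype μ]

/-- The map of realizations induced by a map that preserves the relation. -/
def map (f : ι → κ) (hf : ∀ a b, R a b → S (f a) (f b)) :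
    C(cliqueRealization R, cliqueRealization S) where
  toFun x := ⟨fun k => ∑ a with f a = k, x.1 a,
    ⟨fun _ => Finset.sum_nonneg fun a _ => x.2.1.1 a, by
      rw [Finset.sum_fiberwise]; exact x.2.1.2⟩,
    fun k l hk hl => by
      obtain ⟨a, rfl, ha⟩ := exists_of_sum_filter_ne_zero hk
      obtain ⟨b, rfl, hb⟩ := exists_of_sum_filter_ne_zero hl
      exact hf a b (x.2.2 a b ha hb)⟩
  continuous_toFun := by fun_prop

theorem map_apply (f : ι → κ) (hf : ∀ a b, R a b → S (f a) (f b)) (x : cliqueRealization R)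
    (k : κ) : (map f hf x).1 k = ∑ a with f a = k, x.1 a := rfl

theorem map_comp_map (g : κ → μ) (hg : ∀ a b, S a b → T (g a) (g b))
    (f : ι → κ) (hf : ∀ a b, R a b → S (f a) (f b)) :
    (map g hg).comp (map f hf) =
      map (fun a => g (f a)) (fun a b h => hg _ _ (hf a b h)) := by
  ext x m
  simp only [ContinuousMap.comp_apply, map_apply]
  rw [← Finset.sum_fiberwise_of_maps_to (s := {a | g (f a) = m}) (t := {k | g k = m}) (g := f)
    (by simp)]
  refine Finset.sum_congr rfl fun k hk => Finset.sum_congr ?_ fun _ _ => rfl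
  ext a
  have := (Finset.mem_filter.1 hk).2
  simp only [Finset.mem_filter, Finset.mem_univ, true_and]
  exact ⟨fun h => ⟨h ▸ this, h⟩, fun h => h.2⟩

theorem map_id (hf : ∀ a b, S a b → S (id a) (id b)) :
    map (R := S) (S := S) id hf = ContinuousMap.id _ := by
  ext x k
  simp [map_apply, Finset.sum_filter]

/-- Source of all the combinatorial homotopies: contiguity need only be checked on related pairs of
vertices. -/
theorem map_homotopic_map [Std.Symm S] (f g : ι → κ)
    (hf : ∀ a b, R a b → S (f a) (f b)) (hg : ∀ a b, R a b → S (g a) (g b))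
    (h : ∀ a b, R a b → S (f a) (g b)) :
    (map f hf).Homotopic (map g hg) := by
  refine homotopic_of_contiguous _ _ fun x k l hk hl => ?_
  obtain ⟨a, rfl, ha⟩ := exists_of_sum_filter_ne_zero hk
  obtain ⟨b, rfl, hb⟩ := exists_of_sum_filter_ne_zero hl
  exact h a b (x.2.2 a b ha hb)

end cliqueRealization

/-! ### The boundary of the cross-polytope is a sphere. -/

section crossPolytope

variable {m : ℕ}

/-- Two vertices of the cross-polytope are related unless they are antipodal. -/
def crossPolytopeRel (m : ℕ) (p q : Fin m × Bool) : Prop := p.1 = q.1 → p.2 = q.2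

/-- The signed coordinates of a point of the boundary of the cross-polytope. -/
noncomputable def signedCoord (x : Fin m × Bool → ℝ) : EuclideanSpace ℝ (Fin m) :=
  WithLp.toLp 2 fun i => x (i, true) - x (i, false)

theorem continuous_signedCoord : Continuous (signedCoord (m := m)) := by
  unfold signedCoord; fun_prop

/-- Antipodal vertices share no face, so one of the two coordinates vanishes and the signed
coordinate determines both. -/
theorem max_signedCoord (x : cliqueRealization (crossPolytopeRel m)) (i : Fin m) :
    max (signedCoord x.1 i) 0 = x.1 (i, true) ∧ max (-signedCoord x.1 i) 0 = x.1 (i, false) := by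
  have h0 := x.2.1.1 (i, true)
  have h1 := x.2.1.1 (i, false)
  have h2 := x.2.2 (i, true) (i, false)
  have h3 : signedCoord x.1 i = x.1 (i, true) - x.1 (i, false) := rfl
  rw [h3]
  by_cases ht : x.1 (i, true) = 0
  · rw [ht]; simp [h1]
  · by_cases hf : x.1 (i, false) = 0
    · rw [hf]; simp [h0]
    · simpa using h2 ht hf rfl

theorem sum_abs_signedCoord (x : cliqueRealization (crossPolytopeRel m)) :
    ∑ i, |signedCoord x.1 i| = 1 := by
  rw [← x.2.1.2, Fintype.sum_prod_type]
  refine Finset.sum_congr rfl fun i _ => ?_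
  rw [Fintype.sum_bool, ← (max_signedCoord x i).1, ← (max_signedCoord x i).2]
  exact (posPart_add_negPart _).symm

theorem signedCoord_ne_zero (x : cliqueRealization (crossPolytopeRel m)) :
    signedCoord x.1 ≠ 0 := by
  intro h
  have := sum_abs_signedCoord x
  simp [h] at this

theorem sum_abs_pos {y : EuclideanSpace ℝ (Fin m)} (hy : y ≠ 0) : 0 < ∑ i, |y i| := by
  refine (Finset.sum_nonneg fun i _ => abs_nonneg _).lt_of_ne' fun h => hy ?_
  ext i
  simpa using (Finset.sum_eq_zero_iff_of_nonneg fun i _ => abs_nonneg _).1 h i (Finset.mem_univ i)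

/-- The boundary of the cross-polytope is homeomorphic to the sphere, by radial projection. -/
noncomputable def crossPolytopeHomeomorph (m : ℕ) : cliqueRealization (crossPolytopeRel m) ≃ₜ
    Metric.sphere (0 : EuclideanSpace ℝ (Fin m)) 1 where
  toFun x := ⟨‖signedCoord x.1‖⁻¹ • signedCoord x.1, by
    simp [norm_smul, signedCoord_ne_zero x]⟩
  invFun y := ⟨fun p => (∑ i, |y.1 i|)⁻¹ * max (if p.2 then y.1 p.1 else -y.1 p.1) 0, by
    have hy : (y.1 : EuclideanSpace ℝ (Fin m)) ≠ 0 := ne_zero_of_mem_unit_sphere y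
    refine ⟨⟨fun p => mul_nonneg (inv_nonneg.2 (sum_abs_pos hy).le) (le_max_right _ _), ?_⟩, ?_⟩
    · rw [← Finset.mul_sum, Fintype.sum_prod_type]
      have : ∀ i, ∑ b : Bool, max (if b then y.1 i else -y.1 i) 0 = |y.1 i| := fun i => by
        rw [Fintype.sum_bool]; exact posPart_add_negPart _
      simp only [this]
      exact inv_mul_cancel₀ (sum_abs_pos hy).ne'
    · rintro ⟨i, a⟩ ⟨j, b⟩ ha hb (rfl : i = j)
      have ha' := right_ne_zero_of_mul ha
      have hb' := right_ne_zero_of_mul hb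
      by_contra hab
      cases a <;> cases b <;> simp at hab ha' hb' <;> linarith⟩
  left_inv x := by
    have hn := norm_pos_iff.2 (signedCoord_ne_zero x)
    ext ⟨i, b⟩
    have h1 : ∀ t : ℝ, max (‖signedCoord x.1‖⁻¹ * t) 0 = ‖signedCoord x.1‖⁻¹ * max t 0 := by
      intro t
      rw [mul_max_of_nonneg _ _ (inv_nonneg.2 hn.le), mul_zero]
    simp only [PiLp.smul_apply, smul_eq_mul, abs_mul, ← Finset.mul_sum, sum_abs_signedCoord,
      abs_inv, abs_norm, mul_one, inv_inv]
    cases b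
    · simp only [Bool.false_eq_true, if_false, ← mul_neg, h1, max_signedCoord]
      field_simp
    · simp only [if_true, h1, max_signedCoord]
      field_simp
  right_inv y := by
    have hy : (y.1 : EuclideanSpace ℝ (Fin m)) ≠ 0 := ne_zero_of_mem_unit_sphere y
    have hs := sum_abs_pos hy
    have h : signedCoord (fun p : Fin m × Bool =>
        (∑ i, |y.1 i|)⁻¹ * max (if p.2 then y.1 p.1 else -y.1 p.1) 0) =
        (∑ i, |y.1 i|)⁻¹ • y.1 := by
      ext i
      simp only [signedCoord, PiLp.smul_apply, smul_eq_mul, if_true, Bool.false_eq_true, if_false,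
        ← mul_sub]
      congr 1
      exact posPart_sub_negPart _
    apply Subtype.ext
    simp only [h, norm_smul, norm_eq_of_mem_sphere y, norm_inv, Real.norm_eq_abs, abs_of_pos hs,
      mul_one, inv_inv, smul_smul, mul_inv_cancel₀ hs.ne', one_smul]
  continuous_toFun := by
    have h : Continuous fun x : cliqueRealization (crossPolytopeRel m) => signedCoord x.1 :=
      continuous_signedCoord.comp continuous_subtype_val
    exact ((h.norm.inv₀ fun x => norm_ne_zero_iff.2 (signedCoord_ne_zero x)).smul h).subtype_mk _
  continuous_invFun := by
    have h : Continuous fun y : Metric.sphere (0 : EuclideanSpace ℝ (Fin m)) 1 =>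
        (∑ i, |y.1 i|)⁻¹ := by
      refine Continuous.inv₀ (by fun_prop) fun y => (sum_abs_pos ?_).ne'
      exact ne_zero_of_mem_unit_sphere y
    refine Continuous.subtype_mk (continuous_pi fun p => h.mul (Continuous.max ?_ ?_)) _
    · split_ifs <;> fun_prop
    · fun_prop

end crossPolytope

/-! ### Folding the complex of tiles. -/

namespace SimpleGraph

/-- The relation on pairs `(a, b)` saying that both are intervals `{a, …, b}` of one or two columns,
and that these intervals are disjoint or equal. -/
def tileRel (n : ℕ) (p q : Fin n × Fin n) : Prop :=
  p.1.1 ≤ p.2.1 ∧ p.2.1 ≤ p.1.1 + 1 ∧ q.1.1 ≤ q.2.1 ∧ q.2.1 ≤ q.1.1 + 1 ∧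
    (p.2.1 < q.1.1 ∨ q.2.1 < p.1.1 ∨ p.1.1 = q.1.1 ∧ p.2.1 = q.2.1)

instance (n : ℕ) : Std.Symm (tileRel n) where
  symm p q h := by unfold tileRel at *; omega

/-- The map that fixes, for even `a < 2 * j`, the tiles `(a, a)` and `(a, a + 1)`, sends the other
tiles that begin in the columns `a` and `a + 1` to `(a, a)`, and fixes the tiles that begin in the
columns from `2 * j` on. -/
def foldTile {n : ℕ} (j : ℕ) (p : Fin n × Fin n) : Fin n × Fin n :=
  if p.1.1 < 2 * j then
    if p.1.1 % 2 = 0 ∧ p.2.1 = p.1.1 + 1 then p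
    else (⟨2 * (p.1.1 / 2), by omega⟩, ⟨2 * (p.1.1 / 2), by omega⟩)
  else p

variable {n : ℕ}

theorem foldTile_fst (j : ℕ) (p : Fin n × Fin n) :
    (foldTile j p).1.1 = if p.1.1 < 2 * j then 2 * (p.1.1 / 2) else p.1.1 := by
  unfold foldTile
  split_ifs <;> grind

theorem foldTile_snd (j : ℕ) (p : Fin n × Fin n) :
    (foldTile j p).2.1 = if p.1.1 < 2 * j then
      if p.1.1 % 2 = 0 ∧ p.2.1 = p.1.1 + 1 then p.2.1 else 2 * (p.1.1 / 2) else p.2.1 := by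
  unfold foldTile
  split_ifs <;> simp

/-- Tiles starting before column 2j already fold into columns before 2j. So among the folded tiles
only (2j, 2j+1) conflicts with (2j, 2j), and it also conflicts with every tile starting in column
2j+1. -/
theorem tileRel_foldTile_succ (j : ℕ) (p q : Fin n × Fin n) (h : tileRel n p q) :
    tileRel n (foldTile j p) (foldTile (j + 1) q) := by
  unfold tileRel at *
  simp only [foldTile_fst, foldTile_snd]
  split_ifs <;> omega

theorem tileRel_foldTile (j : ℕ) (p q : Fin n × Fin n) (h : tileRel n p q) :
    tileRel n (foldTile j p) (foldTile j q) := by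
  unfold tileRel at *
  simp only [foldTile_fst, foldTile_snd]
  split_ifs <;> omega

open cliqueRealization

theorem foldTile_homotopic_id (j : ℕ) :
    (map _ (tileRel_foldTile (n := n) j)).Homotopic (ContinuousMap.id _) := by
  induction j with
  | zero =>
    rw [← cliqueRealization.map_id (fun _ _ => id)]
    exact map_homotopic_map _ _ _ _ fun p q h => by simpa [foldTile] using h
  | succ j ih =>
    exact (map_homotopic_map _ _ _ _ (tileRel_foldTile_succ j)).symm.trans ih

theorem contractibleSpace_tile (m : ℕ) :
    ContractibleSpace (cliqueRealization (tileRel (2 * m + 1))) := by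
  let p : Fin (2 * m + 1) × Fin (2 * m + 1) := (Fin.last _, Fin.last _)
  have hp : tileRel _ p p := by simp [tileRel, p]
  -- After folding, `p` is the only tile that meets the last column, hence a cone point.
  have h := map_homotopic_map (foldTile m) (fun _ => p) (tileRel_foldTile m)
    (fun _ _ _ => hp) (fun a b h => by
      unfold tileRel at *
      simp only [foldTile_fst, foldTile_snd, p, Fin.val_last]
      split_ifs <;> omega)
  rw [contractible_iff_id_nullhomotopic]
  refine ⟨⟨Pi.single p 1, single_mem_stdSimplex ℝ p, fun a b ha hb => ?_⟩,
    (foldTile_homotopic_id m).symm.trans (h.trans ?_)⟩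
  · have key : ∀ a, (Pi.single p 1 : _ → ℝ) a ≠ 0 → a = p := fun a ha => by
      by_contra hc
      exact ha (Pi.single_eq_of_ne hc 1)
    rw [key a ha, key b hb]
    exact hp
  · convert ContinuousMap.Homotopic.refl _ using 1
    ext x k
    by_cases hk : k = p
    · subst hk
      simp [map_apply, x.2.1.2]
    · simp [map_apply, hk, Ne.symm hk]

/-- The vertex of the cross-polytope that a tile beginning in the columns `2 * i`, `2 * i + 1` is
folded to. -/
def tileToCross (m : ℕ) (p : Fin (2 * m) × Fin (2 * m)) : Fin m × Bool :=
  (⟨p.1.1 / 2, by omega⟩, decide (p.1.1 % 2 = 0 ∧ p.2.1 = p.1.1 + 1))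

/-- The tiles that are the vertices of the cross-polytope. -/
def crossToTile (m : ℕ) (c : Fin m × Bool) : Fin (2 * m) × Fin (2 * m) :=
  (⟨2 * c.1.1, by omega⟩, ⟨2 * c.1.1 + if c.2 then 1 else 0, by split_ifs <;> omega⟩)

theorem nonempty_tile_homotopyEquiv (m : ℕ) :
    Nonempty (cliqueRealization (tileRel (2 * m)) ≃ₕ cliqueRealization (crossPolytopeRel m)) := by
  have hf : ∀ p q, tileRel (2 * m) p q →
      crossPolytopeRel m (tileToCross m p) (tileToCross m q) := fun p q h => by
    simp only [tileRel, crossPolytopeRel, tileToCross, Fin.mk.injEq, decide_eq_decide] at *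
    omega
  have hg : ∀ c d, crossPolytopeRel m c d →
      tileRel (2 * m) (crossToTile m c) (crossToTile m d) := by
    rintro ⟨⟨i, hi⟩, b⟩ ⟨⟨j, hj⟩, c⟩ h
    simp only [tileRel, crossPolytopeRel, crossToTile, Fin.mk.injEq] at *
    cases b <;> cases c <;> simp at h ⊢ <;> omega
  refine ⟨⟨map _ hf, map _ hg, ?_, ?_⟩⟩
  · rw [map_comp_map]
    -- The composite on tiles is exactly `foldTile m`.
    convert foldTile_homotopic_id m using 1
    congr 1
    funext p
    ext
    · simp only [crossToTile, tileToCross, foldTile_fst]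
      split_ifs <;> omega
    · simp only [crossToTile, tileToCross, foldTile_snd, decide_eq_true_eq]
      split_ifs <;> omega
  · rw [map_comp_map, ← cliqueRealization.map_id (fun _ _ => id)]
    convert ContinuousMap.Homotopic.refl _ using 1
    congr 1
    funext c
    obtain ⟨i, b⟩ := c
    cases b <;> simp [crossToTile, tileToCross]

/-! ### From edges to tiles. -/

/-- The columns of the leftmost and the rightmost vertex of an edge. -/
def edgeToTile (e : Sym2 (Fin n × Fin 2)) : Fin n × Fin n :=
  ((e.map Prod.fst).inf, (e.map Prod.fst).sup)

/-- Two edges of the grid are related if the sets of columns they meet are disjoint or equal. -/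
def edgeRel (n : ℕ) (e f : Sym2 (Fin n × Fin 2)) : Prop :=
  e ∈ (gridGraph n).edgeSet ∧ f ∈ (gridGraph n).edgeSet ∧ tileRel n (edgeToTile e) (edgeToTile f)

instance (n : ℕ) : Std.Symm (edgeRel n) where
  symm _ _ h := ⟨h.2.1, h.1, _root_.symm h.2.2⟩

/-- An edge of the grid that meets exactly the columns of a tile. -/
def tileToEdge (p : Fin n × Fin n) : Sym2 (Fin n × Fin 2) :=
  s((p.1, 0), (p.2, if p.1 = p.2 then 1 else 0))

theorem gridGraph_adj {a b : Fin n × Fin 2} : (gridGraph n).Adj a b ↔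
    (a.1.1 + 1 = b.1.1 ∨ b.1.1 + 1 = a.1.1) ∧ a.2 = b.2 ∨ a.2 ≠ b.2 ∧ a.1 = b.1 := by
  unfold gridGraph
  rw [boxProd_adj, pathGraph_two_eq_top, pathGraph_adj, top_adj]

theorem edgeToTile_bounds {e : Sym2 (Fin n × Fin 2)} (he : e ∈ (gridGraph n).edgeSet) :
    (edgeToTile e).1.1 ≤ (edgeToTile e).2.1 ∧ (edgeToTile e).2.1 ≤ (edgeToTile e).1.1 + 1 := by
  induction e with
  | _ a b =>
    rw [mem_edgeSet, gridGraph_adj] at he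
    simp only [edgeToTile, Sym2.map_mk, Sym2.inf_mk, Sym2.sup_mk]
    rcases le_total a.1 b.1 with h | h
    · rw [inf_eq_left.2 h, sup_eq_right.2 h]; omega
    · rw [inf_eq_right.2 h, sup_eq_left.2 h]; omega

theorem edgeToTile_tileToEdge {p : Fin n × Fin n} (h : p.1.1 ≤ p.2.1) :
    edgeToTile (tileToEdge p) = p := by
  simp [edgeToTile, tileToEdge, Fin.le_def.2 h]

theorem tileToEdge_mem {p : Fin n × Fin n} (h : p.1.1 ≤ p.2.1) (h' : p.2.1 ≤ p.1.1 + 1) :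
    tileToEdge p ∈ (gridGraph n).edgeSet := by
  rw [tileToEdge, mem_edgeSet, gridGraph_adj]
  by_cases hp : p.1 = p.2
  · simp [hp]
  · have := fun h => hp (Fin.ext h)
    simp only [hp, if_false, and_true]
    omega

theorem edgeRel_tileToEdge {p q : Fin n × Fin n} (h : tileRel n p q) :
    edgeRel n (tileToEdge p) (tileToEdge q) :=
  ⟨tileToEdge_mem h.1 h.2.1, tileToEdge_mem h.2.2.1 h.2.2.2.1, by
    rwa [edgeToTile_tileToEdge h.1, edgeToTile_tileToEdge h.2.2.1]⟩

theorem nonempty_edge_homotopyEquiv (n : ℕ) :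
    Nonempty (cliqueRealization (edgeRel n) ≃ₕ cliqueRealization (tileRel n)) := by
  refine ⟨⟨map edgeToTile fun _ _ h => h.2.2,
    map tileToEdge fun _ _ => edgeRel_tileToEdge, ?_, ?_⟩⟩
  · rw [map_comp_map, ← cliqueRealization.map_id (fun _ _ => id)]
    -- The composite may change the row of an edge but not its tile, and `edgeRel` sees only tiles.
    refine map_homotopic_map _ _ _ _ fun e f h => ?_
    have ht := h.2.2
    refine ⟨tileToEdge_mem ht.1 ht.2.1, h.2.1, ?_⟩
    rwa [edgeToTile_tileToEdge ht.1]
  · rw [map_comp_map, ← cliqueRealization.map_id (fun _ _ => id)]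
    refine map_homotopic_map _ _ _ _ fun p q h => ?_
    rwa [edgeToTile_tileToEdge h.1]

/-! ### The perfect matching complex is flag. -/

/-- In a perfect matching of the grid, horizontal edges come in pairs. -/
theorem Subgraph.IsPerfectMatching.adj_other_row {M : (gridGraph n).Subgraph}
    (hM : M.IsPerfectMatching) {i i' : Fin n} {j j' : Fin 2} (hi : i.1 + 1 = i'.1)
    (h : M.Adj (i, j) (i', j)) : M.Adj (i, j') (i', j') := by
  obtain ⟨a, ha⟩ : ∃ a, i.1 = a := ⟨_, rfl⟩
  induction a using Nat.strong_induction_on generalizing i i' j j' with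
  | _ a ih =>
    by_cases hj : j = j'
    · exact hj ▸ h
    -- The partner of `(i, j')` must lie to the right: a vertical edge would meet the given edge,
    -- and so would a leftward one once induction copies it to row `j`.
    obtain ⟨⟨c, l⟩, hc, -⟩ := hM.1 (hM.2 (i, j'))
    have hadj := gridGraph_adj.1 hc.adj_sub
    simp only at hadj
    rcases hadj with ⟨hci | hci, rfl⟩ | ⟨hl, rfl⟩
    · obtain rfl : c = i' := Fin.ext (by omega)
      exact hc
    · have := ih c.1 (by omega) (j' := j) hci hc.symm rfl
      have := hM.1.eq_of_adj_left h this.symm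
      simp only [Prod.mk.injEq] at this
      omega
    · obtain rfl : l = j := by omega
      have := hM.1.eq_of_adj_left h hc.symm
      simp only [Prod.mk.injEq] at this
      omega

theorem exists_eq_of_mem_edgeSet {e : Sym2 (Fin n × Fin 2)} (he : e ∈ (gridGraph n).edgeSet) :
    ∃ a b j l, e = s((a, j), (b, l)) ∧ edgeToTile e = (a, b) ∧
      (a.1 + 1 = b.1 ∧ j = l ∨ a = b ∧ j ≠ l) := by
  induction e with
  | _ x y =>
    obtain ⟨a, j⟩ := x
    obtain ⟨b, l⟩ := y
    rw [mem_edgeSet, gridGraph_adj] at he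
    rcases le_total a b with h | h
    · refine ⟨a, b, j, l, rfl, ?_, ?_⟩
      · simp [edgeToTile, h]
      · simp only at he; omega
    · refine ⟨b, a, l, j, Sym2.eq_swap, ?_, ?_⟩
      · simp [edgeToTile, h]
      · simp only at he; omega

theorem Subgraph.IsPerfectMatching.edgeRel {M : (gridGraph n).Subgraph}
    (hM : M.IsPerfectMatching) {e f : Sym2 (Fin n × Fin 2)} (he : e ∈ M.edgeSet)
    (hf : f ∈ M.edgeSet) : edgeRel n e f := by
  have he' := M.edgeSet_subset he
  have hf' := M.edgeSet_subset hf
  refine ⟨he', hf', ?_⟩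
  obtain ⟨a, b, j, l, rfl, ht, h⟩ := exists_eq_of_mem_edgeSet he'
  obtain ⟨c, d, j', l', rfl, ht', h'⟩ := exists_eq_of_mem_edgeSet hf'
  rw [ht, ht']
  rw [Subgraph.mem_edgeSet] at he hf
  -- Both edges can be moved to any row, where they meet only if they are equal.
  have key : ∀ {a b c d : Fin n} {j l j' l' : Fin 2}, M.Adj (a, j) (b, l) → M.Adj (c, j') (d, l') →
      a.1 + 1 = b.1 ∧ j = l → (c.1 + 1 = d.1 ∧ j' = l' ∨ c = d ∧ j' ≠ l') →
      b.1 < c.1 ∨ d.1 < a.1 ∨ a.1 = c.1 ∧ b.1 = d.1 := by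
    rintro a b c d j l j' l' he hf ⟨h, rfl⟩ h'
    have h1 := hM.adj_other_row (j' := j') h he
    by_contra! hcon
    by_cases hac : a = c
    · subst hac
      have := hM.1.eq_of_adj_left h1 hf
      simp only [Prod.mk.injEq] at this
      omega
    · by_cases hbc : b = c
      · subst hbc
        have := hM.1.eq_of_adj_left h1.symm hf
        simp only [Prod.mk.injEq] at this
        omega
      · obtain rfl : a = d := Fin.ext (by omega)
        have h2 := hM.adj_other_row (j' := l') h he
        have := hM.1.eq_of_adj_left h2 hf.symm
        simp only [Prod.mk.injEq] at this
        omega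
  have h3 : b.1 < c.1 ∨ d.1 < a.1 ∨ a.1 = c.1 ∧ b.1 = d.1 := by
    by_cases hh : a.1 + 1 = b.1
    · exact key he hf (by omega) h'
    · by_cases hh' : c.1 + 1 = d.1
      · have := key hf he (by omega) h
        omega
      · omega
  refine ⟨?_, ?_, ?_, ?_, h3⟩ <;> dsimp only <;> omega

/-- The perfect matching of the grid that has horizontal edges exactly in the columns `i`, `i + 1`
with `i ∈ A`. -/
def tilingSubgraph (n : ℕ) (A : Set ℕ) : (gridGraph n).Subgraph where
  verts := Set.univ
  Adj x y := (x.1 = y.1 ∧ x.2 ≠ y.2 ∧ x.1.1 ∉ A ∧ ∀ a ∈ A, a + 1 ≠ x.1.1) ∨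
    (x.2 = y.2 ∧ x.1.1 + 1 = y.1.1 ∧ x.1.1 ∈ A) ∨ (x.2 = y.2 ∧ y.1.1 + 1 = x.1.1 ∧ y.1.1 ∈ A)
  adj_sub {x y} h := by
    rw [gridGraph_adj]
    tauto
  edge_vert _ := Set.mem_univ _
  symm := ⟨fun x y h => by
    rcases h with h | h | h
    · exact Or.inl ⟨h.1.symm, h.2.1.symm, h.1 ▸ h.2.2⟩
    · exact Or.inr (Or.inr ⟨h.1.symm, h.2⟩)
    · exact Or.inr (Or.inl ⟨h.1.symm, h.2⟩)⟩

theorem isPerfectMatching_tilingSubgraph {A : Set ℕ} (hA : ∀ a ∈ A, a + 1 < n)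
    (hA' : ∀ a ∈ A, a + 1 ∉ A) : (tilingSubgraph n A).IsPerfectMatching := by
  refine ⟨?_, fun _ => Set.mem_univ _⟩
  rintro ⟨⟨i, hi⟩, j⟩ -
  by_cases h1 : i ∈ A
  · refine ⟨(⟨i + 1, hA i h1⟩, j), Or.inr (Or.inl ⟨rfl, rfl, h1⟩), ?_⟩
    rintro ⟨⟨c, hc⟩, l⟩ (h | h | h) <;> simp only [Fin.mk.injEq, Prod.mk.injEq] at h ⊢
    · exact absurd h1 h.2.2.1
    · omega
    · exact absurd h1 (h.2.1 ▸ hA' _ h.2.2)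
  by_cases h2 : ∃ a ∈ A, a + 1 = i
  · obtain ⟨a, ha, rfl⟩ := h2
    refine ⟨(⟨a, by omega⟩, j), Or.inr (Or.inr ⟨rfl, rfl, ha⟩), ?_⟩
    rintro ⟨⟨c, hc⟩, l⟩ (h | h | h) <;> simp only [Fin.mk.injEq, Prod.mk.injEq] at h ⊢
    · exact absurd rfl (h.2.2.2 a ha)
    · exact absurd h.2.2 h1
    · omega
  · push Not at h2
    refine ⟨(⟨i, hi⟩, 1 - j), Or.inl ⟨rfl, by dsimp only; omega, h1, h2⟩, ?_⟩
    rintro ⟨⟨c, hc⟩, l⟩ (h | h | h) <;> simp only [Fin.mk.injEq, Prod.mk.injEq] at h ⊢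
    · omega
    · exact absurd h.2.2 h1
    · exact absurd h.2.1 (h2 _ h.2.2)

theorem exists_isPerfectMatching {s : Set (Sym2 (Fin n × Fin 2))}
    (hs : ∀ e ∈ s, ∀ f ∈ s, edgeRel n e f) :
    ∃ M : (gridGraph n).Subgraph, M.IsPerfectMatching ∧ s ⊆ M.edgeSet := by
  -- Left columns of the horizontal edges of `s`; vertical edges fill the columns not covered by
  -- these pairs.
  let A : Set ℕ := {i | ∃ e ∈ s, (edgeToTile e).1.1 = i ∧ (edgeToTile e).2.1 = i + 1}
  refine ⟨tilingSubgraph n A, isPerfectMatching_tilingSubgraph ?_ ?_, ?_⟩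
  · rintro a ⟨e, -, -, h⟩
    omega
  · rintro a ⟨e, he, h1, h2⟩ ⟨f, hf, h3, h4⟩
    have := (hs e he f hf).2.2.2.2.2.2
    omega
  · intro e he
    obtain ⟨a, b, j, l, rfl, ht, h⟩ := exists_eq_of_mem_edgeSet (hs e he e he).1
    rw [Subgraph.mem_edgeSet]
    rcases h with ⟨h, rfl⟩ | ⟨rfl, h⟩
    · exact Or.inr (Or.inl ⟨rfl, h, _, he, by rw [ht], by rw [ht]; exact h.symm⟩)
    · refine Or.inl ⟨rfl, h, ?_, ?_⟩
      · rintro ⟨f, hf, h1, h2⟩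
        have := (hs _ he f hf).2.2.2.2.2.2
        rw [ht] at this
        change _ = a.1 at h1
        dsimp only at this h2
        omega
      · rintro c ⟨f, hf, h1, h2⟩ h3
        have := (hs _ he f hf).2.2.2.2.2.2
        rw [ht] at this
        change _ = a.1 at h3
        dsimp only at this
        omega

theorem realization_perfectMatchingComplex (n : ℕ) :
    (gridGraph n).perfectMatchingComplex.realization = cliqueRealization (edgeRel n) := by
  classical
  ext x
  refine and_congr_right fun hx => ⟨?_, fun h => ?_⟩
  · rintro ⟨s, ⟨-, M, hM, hsM⟩, hxs⟩ e f he hf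
    exact hM.edgeRel (hsM (hxs he)) (hsM (hxs hf))
  · obtain ⟨M, hM, hsM⟩ := exists_isPerfectMatching (s := Function.support x)
      fun e he f hf => h e f he hf
    refine ⟨Finset.univ.filter fun e => x e ≠ 0, ⟨?_, M, hM, fun e he => hsM (by simpa using he)⟩,
      fun e he => by simpa using he⟩
    -- Faces must be nonempty; the support is, since the coordinates sum to 1.
    obtain ⟨e, -, he⟩ := Finset.exists_ne_zero_of_sum_ne_zero (hx.2.trans_ne one_ne_zero)
    exact ⟨e, by simpa using he⟩

end SimpleGraph

theorem mainTheorem1 (n : ℕ) :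
    (Odd n →
      ContractibleSpace (SimpleGraph.gridGraph n).perfectMatchingComplex.realization) ∧
    (∀ k : ℕ, n = 2 * k + 2 →
      Nonempty ((SimpleGraph.gridGraph n).perfectMatchingComplex.realization ≃ₕ
        Metric.sphere (0 : EuclideanSpace ℝ (Fin (k + 1))) 1)) := by
  rw [SimpleGraph.realization_perfectMatchingComplex]
  obtain ⟨e⟩ := SimpleGraph.nonempty_edge_homotopyEquiv n
  refine ⟨?_, ?_⟩
  · rintro ⟨m, rfl⟩
    have := SimpleGraph.contractibleSpace_tile m
    exact e.contractibleSpace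
  · rintro k rfl
    obtain ⟨f⟩ := SimpleGraph.nonempty_tile_homotopyEquiv (k + 1)
    exact ⟨(e.trans f).trans (crossPolytopeHomeomorph (k + 1)).toHomotopyEquiv⟩
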